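/- **Setting.** Let $m,p,s\ge 1$ be integers, $\|\cdot\|$ the induced 2-norm, and, for a real matrix $A$ with linearly independent columns, $\kappa(A)=\sigma_{\max}(A)/\sigma_{\min}(A)$ its 2-norm condition number. Let $\boldsymbol{\mathcal X}=[X_1,\dots,X_p]\in\mathbb R^{m\times ps}$ with blocks $X_k\in\mathbb R^{m\times s}$ have linearly independent columns. Given two intraorthogonalization routines $\mathtt{IO}_A$ and $\mathtt{IO}$, which map an $m\times s$ matrix to a computed pair $[\bar Q,\bar R]$ with $\bar Q\in\mathbb R^{m\times s}$, $\bar R\in\mathbb R^{s\times s}$, the algorithm BCGS-A computes $$[Q_1,R_{11}]=\mathtt{IO}_A(X_1),\qquad\text{and for }k=2,\dots,p:\quad R_{1:k-1,k}=[Q_1,\dots,Q_{k-1}]^TX_k,\quad [Q_k,R_{kk}]=\mathtt{IO}\bigl(X_k-[Q_1,\dots,Q_{k-1}]R_{1:k-1,k}\bigr),$$ and returns $\mathcal Q=[Q_1,\dots,Q_p]$ and the block upper triangular matrix $\mathcal R=(R_{ij})$. Let $\bar{\mathcal Q},\bar{\mathcal R}$ be computed results in floating-point arithmetic with unit roundoff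 $\varepsilon>0$ under the standard model: every addition, subtraction and multiplication outside the two routines returns its exact result times $1+\delta$ for some $|\delta|\le\varepsilon$, and the sums in matrix products are evaluated in any order. **Theorem.** For all real $\alpha_A,\alpha,c\ge 0$ there are constants $C_0,C>0$, depending only on $m,p,s,\alpha_A,\alpha,c$, such that the following holds for all such $\varepsilon$, $\boldsymbol{\mathcal X}$, $\mathtt{IO}_A$, $\mathtt{IO}$, $\bar{\mathcal Q}$, $\bar{\mathcal R}$. Assume that for every $X\in\mathbb R^{m\times s}$ with linearly independent columns and $\kappa(X)\le\kappa(\boldsymbol{\mathcal X})$, the pair $[\bar Q,\bar R]=\mathtt{IO}_A(X)$ satisfies $$X+\Delta X=\bar Q\bar R,\quad \|\Delta X\|\le c\,\varepsilon\,\|X\|,\qquad \|I-\bar Q^T\bar Q\|\le c\,\varepsilon\,\kappa(X)^{\alpha_A},\qquad \|I-\bar Q^T\bar Q\|<1,$$ and that for every $X\in\mathbb R^{m\times s}$ with linearly independent columns and $\kappa(X)\le 4p\,\kappa(\boldsymbol{\mathcal X})$, the pair $[\bar Q,\bar R]=\mathtt{IO}(X)$ satisfies $$X+\Delta X=\bar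 Q\bar R,\quad \|\Delta X\|\le c\,\varepsilon\,\|X\|,\qquad \|I-\bar Q^T\bar Q\|\le c\,\varepsilon\,\kappa(X)^{\alpha},\qquad \|I-\bar Q^T\bar Q\|<1.$$ If $C_0\,\varepsilon\,\kappa(\boldsymbol{\mathcal X})\le\frac12$, then $$\boldsymbol{\mathcal X}+\Delta\boldsymbol{\mathcal X}=\bar{\mathcal Q}\bar{\mathcal R}\ \text{ for some }\Delta\boldsymbol{\mathcal X}\text{ with }\ \|\Delta\boldsymbol{\mathcal X}\|\le C\,\varepsilon\,\|\boldsymbol{\mathcal X}\|,\qquad\text{and}\qquad \|I-\bar{\mathcal Q}^T\bar{\mathcal Q}\|\le C\,\varepsilon\,\kappa(\boldsymbol{\mathcal X})^{\,p-2+\max\{\alpha_A+1,\,\alpha\}}.$$ -/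

import Mathlib

open scoped Matrix Matrix.Norms.L2Operator

/-! Throughout, `‖A‖` for a real matrix `A` is the induced 2-norm (`Matrix.Norms.L2Operator`). -/

/-- The largest singular value of a real matrix. -/
noncomputable def sigmaMax {m n : Type} [Fintype m] [Fintype n] [DecidableEq n]
    (A : Matrix m n ℝ) : ℝ :=
  (Matrix.toEuclideanLin A).singularValues 0

/-- The smallest singular value of a real matrix with `card n` columns and at least as many rows
(singular values are listed in decreasing order, with multiplicity). -/
noncomputable def sigmaMin {m n : Type} [Fintype m] [Fintype n] [DecidableEq n]
    (A : Matrix m n ℝ) : ℝ :=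
  (Matrix.toEuclideanLin A).singularValues (Fintype.card n - 1)

/-- The 2-norm condition number, the ratio of the largest to the smallest singular value. It is
only used for matrices whose columns are linearly independent, so the denominator is not `0`. -/
noncomputable def kappa {m n : Type} [Fintype m] [Fintype n] [DecidableEq n]
    (A : Matrix m n ℝ) : ℝ :=
  sigmaMax A / sigmaMin A

/-! ### Floating-point arithmetic: the standard model with unit roundoff `ε`

Every elementary operation returns its exact result times `1 + δ`, for some `|δ| ≤ ε`. -/

/-- `z` is a possible computed value of a real number `e` after one rounding. -/
def FlRound (ε e z : ℝ) : Prop :=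
  ∃ δ : ℝ, |δ| ≤ ε ∧ z = e * (1 + δ)

/-- `z` is a possible computed value of `∑ i ∈ S, t i`, the additions being carried out in floating
point and in any order (any binary summation tree with the elements of `S` as its leaves). -/
inductive FlSum {ι : Type} [DecidableEq ι] (ε : ℝ) (t : ι → ℝ) : Finset ι → ℝ → Prop
  | empty : FlSum ε t ∅ 0
  | single (i : ι) : FlSum ε t {i} (t i)
  | add (S T : Finset ι) (a b z : ℝ) (hS : S.Nonempty) (hT : T.Nonempty) (hST : Disjoint S T)
      (ha : FlSum ε t S a) (hb : FlSum ε t T b) (hz : FlRound ε (a + b) z) :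
      FlSum ε t (S ∪ T) z

/-- `z` is a possible computed value of the inner product of `x` and `y`. -/
def FlDot {ι : Type} [Fintype ι] [DecidableEq ι] (ε : ℝ) (x y : ι → ℝ) (z : ℝ) : Prop :=
  ∃ t : ι → ℝ, (∀ i, FlRound ε (x i * y i) (t i)) ∧ FlSum ε t Finset.univ z

/-- `C` is a possible computed value of the matrix product `A * B`. -/
def FlMatMul {l m n : Type} [Fintype m] [DecidableEq m] (ε : ℝ)
    (A : Matrix l m ℝ) (B : Matrix m n ℝ) (C : Matrix l n ℝ) : Prop :=
  ∀ i j, FlDot ε (fun k => A i k) (fun k => B k j) (C i j)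

/-- `C` is a possible computed value of the matrix difference `A - B`. -/
def FlMatSub {m n : Type} (ε : ℝ) (A B C : Matrix m n ℝ) : Prop :=
  ∀ i j, FlRound ε (A i j - B i j) (C i j)

/-! ### Block matrices

The columns of an `m × ps` matrix are indexed by `Fin p × Fin s`: block, then column in it. -/

/-- The `k`-th block vector `X_k` of `[X_1, …, X_p]`. -/
def blockCol {m p s : ℕ} (X : Matrix (Fin m) (Fin p × Fin s) ℝ) (k : Fin p) :
    Matrix (Fin m) (Fin s) ℝ :=
  Matrix.of fun i a => X i (k, a)

/-- The concatenation `[X_1, …, X_{k-1}]` of the block vectors before the `k`-th one. -/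
def prevCols {m p s : ℕ} (X : Matrix (Fin m) (Fin p × Fin s) ℝ) (k : Fin p) :
    Matrix (Fin m) ({j : Fin p // j < k} × Fin s) ℝ :=
  Matrix.of fun i c => X i (c.1.1, c.2)

/-- The `s × s` block `R_{jk}`. -/
def block {p s : ℕ} (R : Matrix (Fin p × Fin s) (Fin p × Fin s) ℝ) (j k : Fin p) :
    Matrix (Fin s) (Fin s) ℝ :=
  Matrix.of fun a b => R (j, a) (k, b)

/-- The block column `R_{1:k-1,k}`. -/
def prevRows {p s : ℕ} (R : Matrix (Fin p × Fin s) (Fin p × Fin s) ℝ) (k : Fin p) :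
    Matrix ({j : Fin p // j < k} × Fin s) (Fin s) ℝ :=
  Matrix.of fun c b => R (c.1.1, c.2) (k, b)

/-! ### Intraorthogonalization and BCGS-A -/

/-- An intraorthogonalization routine, seen as the map from an input `X` to the computed pair
`(Q, R)`. No property is built in. -/
abbrev Intraortho (m s : ℕ) : Type :=
  Matrix (Fin m) (Fin s) ℝ → Matrix (Fin m) (Fin s) ℝ × Matrix (Fin s) (Fin s) ℝ

/-- On every `m × s` matrix `X` of full column rank with `κ(X) ≤ K`, the routine has backward error
at most `c ε ‖X‖`, and loss of orthogonality at most `c ε κ(X)^α` and less than `1`. -/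
def IntraorthoBounds {m s : ℕ} (ε c α K : ℝ) (io : Intraortho m s) : Prop :=
  ∀ X : Matrix (Fin m) (Fin s) ℝ, LinearIndependent ℝ X.col → kappa X ≤ K →
    (∃ ΔX : Matrix (Fin m) (Fin s) ℝ,
      X + ΔX = (io X).1 * (io X).2 ∧ ‖ΔX‖ ≤ c * ε * ‖X‖) ∧
    ‖1 - (io X).1ᵀ * (io X).1‖ ≤ c * ε * kappa X ^ α ∧
    ‖1 - (io X).1ᵀ * (io X).1‖ < 1

/-- `Q` and `R` are possible computed results of BCGS-A, applied to `X` with the routines `ioA` and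
`io` in floating-point arithmetic with unit roundoff `ε`:
* `[Q_1, R_11] = ioA(X_1)`;
* for `k = 2, …, p`: `R_{1:k-1,k} = Q_{k-1}ᵀ X_k` with `Q_{k-1} = [Q_1, …, Q_{k-1}]`, then
  `[Q_k, R_kk] = io(V)`, where `V` is the computed value of `X_k - Q_{k-1} R_{1:k-1,k}`, and
  `P` that of the product in it;
* the blocks of `R` below the diagonal are zero. -/
structure IsComputedBCGSA {m p s : ℕ} (ε : ℝ) (ioA io : Intraortho m s)
    (X Q : Matrix (Fin m) (Fin p × Fin s) ℝ)
    (R : Matrix (Fin p × Fin s) (Fin p × Fin s) ℝ) : Prop where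
  first : ∀ k : Fin p, k.val = 0 → (blockCol Q k, block R k k) = ioA (blockCol X k)
  proj : ∀ k : Fin p, 0 < k.val →
    FlMatMul ε (prevCols Q k)ᵀ (blockCol X k) (prevRows R k)
  ortho : ∀ k : Fin p, 0 < k.val → ∃ P V : Matrix (Fin m) (Fin s) ℝ,
    FlMatMul ε (prevCols Q k) (prevRows R k) P ∧
    FlMatSub ε (blockCol X k) P V ∧
    (blockCol Q k, block R k k) = io V
  lower : ∀ j k : Fin p, k < j → block R j k = 0

/-! ### Euclidean norm of plain vectors and the induced matrix norm -/

/-! The argument separates the factorization from the orthogonality. Factorization: each routine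
output satisfies ‖I - Q_jᵀQ_j‖ < 1, hence ‖Q_j‖² ≤ 2. This alone keeps every rounding error of a
projection step, and the backward error of the routine, of size ε‖X‖. So D = QR - X is small block
by block, however badly orthogonality between blocks is lost. Why the routine may be called on V_k:
the relation Q_{k-1}R_{k-1} = [X_1, …, X_{k-1}] + D and the invertibility of R_{k-1} show that, up
to errors below a fraction of σ_min(X), V_k v equals X w for a vector w whose k-th block is v
(`lower_bound_of_residual`). So σ_min(V_k) ≥ σ_min(X)/2, and ‖V_k‖ ≤ 2p‖X‖ gives κ(V_k) ≤ 4pκ(X).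
Strong induction on the block then yields `StepBounds` (`stepBounds_of_forall_lt`). Orthogonality:
up to O(ε‖X‖), Q_{k-1}ᵀQ_k R_kk is (I - Q_{k-1}ᵀQ_{k-1}) Q_{k-1}ᵀX_k, and R_kk is bounded below by a
multiple of σ_min(X). Each new block therefore amplifies the earlier loss by at most a multiple of
κ(X) (`norm_prevCols_transpose_mul_blockCol_le`). The first block starts at εκ^αA and undergoes p-1
amplifications; the later routine enters with εκ^α at the second block and undergoes p-2. The larger
exponent is p - 2 + max(αA + 1, α). -/

/-- The Euclidean norm of a vector given by its coordinates. -/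
noncomputable def euclNorm {ι : Type} [Fintype ι] (v : ι → ℝ) : ℝ := ‖WithLp.toLp 2 v‖

section EuclNorm

variable {l m n : Type} [Fintype l] [Fintype m] [Fintype n]

theorem euclNorm_nonneg (v : n → ℝ) : 0 ≤ euclNorm v := norm_nonneg _

theorem euclNorm_zero : euclNorm (0 : n → ℝ) = 0 := by simp [euclNorm]

theorem euclNorm_add_le (v w : n → ℝ) : euclNorm (v + w) ≤ euclNorm v + euclNorm w := by
  simpa [euclNorm] using norm_add_le (WithLp.toLp 2 v) (WithLp.toLp 2 w)

theorem euclNorm_neg (v : n → ℝ) : euclNorm (-v) = euclNorm v := by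
  simp [euclNorm]

theorem euclNorm_sub_le (v w : n → ℝ) : euclNorm (v - w) ≤ euclNorm v + euclNorm w := by
  simpa [euclNorm] using norm_sub_le (WithLp.toLp 2 v) (WithLp.toLp 2 w)

theorem euclNorm_sq (v : n → ℝ) : euclNorm v ^ 2 = ∑ i, v i ^ 2 := by
  simp [euclNorm, EuclideanSpace.norm_sq_eq]

theorem euclNorm_eq_zero {v : n → ℝ} : euclNorm v = 0 ↔ v = 0 := by
  simp [euclNorm]

theorem abs_le_euclNorm (v : n → ℝ) (i : n) : |v i| ≤ euclNorm v := by
  simpa [euclNorm] using PiLp.norm_apply_le (WithLp.toLp 2 v) i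

theorem euclNorm_le_sum_abs (v : n → ℝ) : euclNorm v ≤ ∑ i, |v i| := by
  refine le_of_sq_le_sq ?_ (by positivity)
  rw [euclNorm_sq]
  calc ∑ i, v i ^ 2 = ∑ i, |v i| ^ 2 := by simp
    _ ≤ (∑ i, |v i|) ^ 2 := Finset.sum_sq_le_sq_sum_of_nonneg fun i _ => abs_nonneg _

theorem euclNorm_single [DecidableEq n] (i : n) : euclNorm (Pi.single i (1 : ℝ)) = 1 := by
  simp [euclNorm]

/-- Restricting a vector along an injection does not increase its norm. -/
theorem euclNorm_comp_le {f : m → n} (hf : Function.Injective f) (v : n → ℝ) :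
    euclNorm (fun i => v (f i)) ≤ euclNorm v := by
  refine le_of_sq_le_sq ?_ (euclNorm_nonneg _)
  rw [euclNorm_sq, euclNorm_sq]
  classical
  rw [← Finset.sum_image (s := Finset.univ) (g := f) (f := fun i => v i ^ 2)
    (fun a _ b _ h => hf h)]
  exact Finset.sum_le_sum_of_subset_of_nonneg (Finset.subset_univ _) fun _ _ _ => sq_nonneg _

variable [DecidableEq n]

theorem euclNorm_mulVec_le (A : Matrix m n ℝ) (v : n → ℝ) :
    euclNorm (A *ᵥ v) ≤ ‖A‖ * euclNorm v := by
  simpa [euclNorm] using A.l2_opNorm_mulVec (WithLp.toLp 2 v)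

theorem norm_le_of_euclNorm_mulVec_le (A : Matrix m n ℝ) {c : ℝ} (hc : 0 ≤ c)
    (h : ∀ v, euclNorm (A *ᵥ v) ≤ c * euclNorm v) : ‖A‖ ≤ c := by
  rw [Matrix.l2_opNorm_def]
  refine ContinuousLinearMap.opNorm_le_bound _ hc fun x => ?_
  exact h x.ofLp

theorem abs_apply_le_norm (A : Matrix m n ℝ) (i : m) (j : n) : |A i j| ≤ ‖A‖ := by
  have h := (abs_le_euclNorm _ i).trans (euclNorm_mulVec_le A (Pi.single j 1))
  simpa [euclNorm_single] using h

theorem norm_le_of_abs_apply_le (A : Matrix m n ℝ) {c : ℝ} (hc : 0 ≤ c)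
    (h : ∀ i j, |A i j| ≤ c) : ‖A‖ ≤ Fintype.card m * Fintype.card n * c := by
  refine norm_le_of_euclNorm_mulVec_le _ (by positivity) fun v => ?_
  refine (euclNorm_le_sum_abs _).trans ?_
  have : ∀ i, |(A *ᵥ v) i| ≤ Fintype.card n * c * euclNorm v := fun i => by
    calc |∑ j, A i j * v j| ≤ ∑ j, |A i j * v j| := Finset.abs_sum_le_sum_abs _ _
      _ ≤ ∑ _j : n, c * euclNorm v := Finset.sum_le_sum fun j _ => by
          rw [abs_mul]
          exact mul_le_mul (h i j) (abs_le_euclNorm v j) (abs_nonneg _) hc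
      _ = Fintype.card n * c * euclNorm v := by simp [mul_assoc]
  refine (Finset.sum_le_sum fun i _ => this i).trans (le_of_eq ?_)
  simp [mul_assoc]

theorem norm_transpose_eq [DecidableEq m] (A : Matrix m n ℝ) : ‖Aᵀ‖ = ‖A‖ := by
  simpa using A.l2_opNorm_conjTranspose

theorem norm_transpose_mul_self_eq (A : Matrix m n ℝ) : ‖Aᵀ * A‖ = ‖A‖ ^ 2 := by
  simpa [sq] using A.l2_opNorm_conjTranspose_mul_self

theorem norm_submatrix_id_le [DecidableEq l] {f : l → n} (hf : Function.Injective f)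
    (A : Matrix m n ℝ) : ‖A.submatrix id f‖ ≤ ‖A‖ := by
  classical
  -- After transposition, selecting columns becomes restricting the coordinates of the image vector.
  rw [← norm_transpose_eq (A.submatrix id f), ← norm_transpose_eq A]
  refine norm_le_of_euclNorm_mulVec_le _ (norm_nonneg _) fun v => ?_
  exact (euclNorm_comp_le hf (Aᵀ *ᵥ v)).trans (euclNorm_mulVec_le _ _)

/-- From ‖AᵀA‖ ≤ ‖I‖ + ‖I - AᵀA‖ ≤ 2. It turns the strict bound on the loss of orthogonality into a
bound on ‖Q_j‖ free of ε and κ. -/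
theorem norm_sq_le_two_of_norm_one_sub_lt (A : Matrix m n ℝ) (h : ‖1 - Aᵀ * A‖ < 1) :
    ‖A‖ ^ 2 ≤ 2 := by
  rw [← norm_transpose_mul_self_eq]
  have h1 : ‖(1 : Matrix n n ℝ)‖ ≤ 1 :=
    norm_le_of_euclNorm_mulVec_le _ zero_le_one fun v => by simp
  have h2 : Aᵀ * A = 1 - (1 - Aᵀ * A) := by abel
  rw [h2]
  exact (norm_sub_le _ _).trans (by linarith)

end EuclNorm

/-! ### Singular values -/

section SingularValues

open Module InnerProductSpace

variable {E F : Type*} [NormedAddCommGroup E] [InnerProductSpace ℝ E] [FiniteDimensional ℝ E]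
  [NormedAddCommGroup F] [InnerProductSpace ℝ F] [FiniteDimensional ℝ F]

/-- Expand `x` in an orthonormal eigenbasis of T*T, whose eigenvalues are the squared singular
values. The extreme singular values then bound the stretching of vectors and are attained on basis
vectors. -/
theorem LinearMap.norm_sq_apply_eq_sum_singularValues (T : E →ₗ[ℝ] F) {n : ℕ}
    (hn : finrank ℝ E = n) (x : E) :
    ‖T x‖ ^ 2 = ∑ i : Fin n, T.singularValues i ^ 2 *
      (inner ℝ (T.isSymmetric_adjoint_comp_self.eigenvectorBasis hn i) x) ^ 2 := by
  set b := T.isSymmetric_adjoint_comp_self.eigenvectorBasis hn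
  have h1 : ‖T x‖ ^ 2 = inner ℝ x ((T.adjoint ∘ₗ T) x) := by
    rw [LinearMap.comp_apply, LinearMap.adjoint_inner_right, real_inner_self_eq_norm_sq]
  rw [h1, ← b.sum_inner_mul_inner x]
  refine Finset.sum_congr rfl fun i _ => ?_
  have h2 := T.isSymmetric_adjoint_comp_self.eigenvectorBasis_apply_self_apply hn x i
  rw [OrthonormalBasis.repr_apply_apply, OrthonormalBasis.repr_apply_apply] at h2
  rw [h2, T.sq_singularValues_fin hn, real_inner_comm]
  change inner ℝ (b i) x * (_ * inner ℝ (b i) x) = _ * inner ℝ (b i) x ^ 2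
  simp only [RCLike.ofReal_real_eq_id, id_eq]
  ring

theorem LinearMap.norm_apply_le_singularValues_zero (T : E →ₗ[ℝ] F) (x : E) :
    ‖T x‖ ≤ T.singularValues 0 * ‖x‖ := by
  refine le_of_sq_le_sq ?_ (mul_nonneg (T.singularValues_nonneg 0) (norm_nonneg _))
  rw [T.norm_sq_apply_eq_sum_singularValues rfl, mul_pow,
    ← (T.isSymmetric_adjoint_comp_self.eigenvectorBasis rfl).sum_sq_inner_right x, Finset.mul_sum]
  refine Finset.sum_le_sum fun i _ => mul_le_mul_of_nonneg_right ?_ (sq_nonneg _)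
  exact pow_le_pow_left₀ (T.singularValues_nonneg _) (T.singularValues_antitone (Nat.zero_le _)) 2

theorem LinearMap.singularValues_last_mul_norm_le (T : E →ₗ[ℝ] F) (x : E) :
    T.singularValues (finrank ℝ E - 1) * ‖x‖ ≤ ‖T x‖ := by
  refine le_of_sq_le_sq ?_ (norm_nonneg _)
  rw [T.norm_sq_apply_eq_sum_singularValues rfl, mul_pow,
    ← (T.isSymmetric_adjoint_comp_self.eigenvectorBasis rfl).sum_sq_inner_right x, Finset.mul_sum]
  refine Finset.sum_le_sum fun i _ => mul_le_mul_of_nonneg_right ?_ (sq_nonneg _)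
  exact pow_le_pow_left₀ (T.singularValues_nonneg _) (T.singularValues_antitone (by omega)) 2

theorem LinearMap.exists_norm_apply_eq_singularValues (T : E →ₗ[ℝ] F) {i : ℕ}
    (hi : i < finrank ℝ E) : ∃ x : E, ‖x‖ = 1 ∧ ‖T x‖ = T.singularValues i := by
  set b := T.isSymmetric_adjoint_comp_self.eigenvectorBasis rfl
  refine ⟨b ⟨i, hi⟩, b.norm_eq_one _, ?_⟩
  refine (sq_eq_sq₀ (norm_nonneg _) (T.singularValues_nonneg _)).mp ?_
  rw [T.norm_sq_apply_eq_sum_singularValues rfl,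
    Finset.sum_eq_single (⟨i, hi⟩ : Fin _)]
  · change _ * (inner ℝ (b _) (b _)) ^ 2 = _
    simp
  · intro j _ hj
    change _ * (inner ℝ (b _) (b _)) ^ 2 = _
    rw [b.inner_eq_zero hj]
    simp
  · simp

end SingularValues

section CondNumber

variable {m n : Type} [Fintype m] [Fintype n] [DecidableEq n]

theorem sigmaMin_mul_euclNorm_le (A : Matrix m n ℝ) (v : n → ℝ) :
    sigmaMin A * euclNorm v ≤ euclNorm (A *ᵥ v) := by
  have := (Matrix.toEuclideanLin A).singularValues_last_mul_norm_le (WithLp.toLp 2 v)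
  simpa [sigmaMin, euclNorm] using this

theorem le_sigmaMin [Nonempty n] (A : Matrix m n ℝ) {c : ℝ}
    (h : ∀ v, c * euclNorm v ≤ euclNorm (A *ᵥ v)) : c ≤ sigmaMin A := by
  obtain ⟨x, hx, hA⟩ := (Matrix.toEuclideanLin A).exists_norm_apply_eq_singularValues
    (i := Fintype.card n - 1) (by simpa using Fintype.card_pos)
  have := h x.ofLp
  have h1 : euclNorm x.ofLp = 1 := hx
  have h2 : euclNorm (A *ᵥ x.ofLp) = sigmaMin A := hA
  simpa [h1, h2] using this

theorem sigmaMax_eq_norm [Nonempty n] (A : Matrix m n ℝ) : sigmaMax A = ‖A‖ := by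
  refine le_antisymm ?_ ?_
  · obtain ⟨x, hx, hA⟩ := (Matrix.toEuclideanLin A).exists_norm_apply_eq_singularValues
      (i := 0) (by simpa using Fintype.card_pos)
    have h1 : euclNorm x.ofLp = 1 := hx
    have h2 : euclNorm (A *ᵥ x.ofLp) = sigmaMax A := hA
    simpa [h1, h2] using euclNorm_mulVec_le A x.ofLp
  · refine norm_le_of_euclNorm_mulVec_le A (LinearMap.singularValues_nonneg _ _) fun v => ?_
    have := (Matrix.toEuclideanLin A).norm_apply_le_singularValues_zero (WithLp.toLp 2 v)
    simpa [sigmaMax, euclNorm] using this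

theorem kappa_eq [Nonempty n] (A : Matrix m n ℝ) : kappa A = ‖A‖ / sigmaMin A := by
  rw [kappa, sigmaMax_eq_norm]

omit [Fintype m] [DecidableEq n] in
theorem linearIndependent_col_of_mulVec {A : Matrix m n ℝ} (h : ∀ v, A *ᵥ v = 0 → v = 0) :
    LinearIndependent ℝ A.col := by
  rw [← Matrix.mulVec_injective_iff]
  intro v w hvw
  exact sub_eq_zero.mp (h _ (by rw [Matrix.mulVec_sub, sub_eq_zero]; exact hvw))

omit [DecidableEq n] in
theorem linearIndependent_col_of_lower_bound {A : Matrix m n ℝ} {c : ℝ} (hc : 0 < c)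
    (h : ∀ v, c * euclNorm v ≤ euclNorm (A *ᵥ v)) : LinearIndependent ℝ A.col := by
  refine linearIndependent_col_of_mulVec fun v hv => ?_
  have h1 := h v
  rw [hv, euclNorm_zero] at h1
  exact euclNorm_eq_zero.mp (le_antisymm (by nlinarith) (euclNorm_nonneg v))

theorem sigmaMin_pos [Nonempty n] {A : Matrix m n ℝ} (h : LinearIndependent ℝ A.col) :
    0 < sigmaMin A := by
  have hinj : Function.Injective (Matrix.toEuclideanLin A) := by
    intro v w hvw
    have := Matrix.mulVec_injective_iff.mpr h (congrArg WithLp.ofLp hvw)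
    exact WithLp.ofLp_injective 2 this
  refine (LinearMap.injective_iff_forall_lt_finrank_singularValues_pos _).mp hinj _ ?_
  simpa using Fintype.card_pos

theorem sigmaMin_le_norm [Nonempty n] (A : Matrix m n ℝ) : sigmaMin A ≤ ‖A‖ := by
  classical
  obtain ⟨i⟩ := ‹Nonempty n›
  have h := (sigmaMin_mul_euclNorm_le A (Pi.single i 1)).trans (euclNorm_mulVec_le A _)
  simpa [euclNorm_single] using h

theorem kappa_le_of [Nonempty n] {A : Matrix m n ℝ} {a b : ℝ} (hb : 0 < b)
    (hA : ‖A‖ ≤ a) (h : ∀ v, b * euclNorm v ≤ euclNorm (A *ᵥ v)) : kappa A ≤ a / b := by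
  rw [kappa_eq]
  exact div_le_div₀ ((norm_nonneg A).trans hA) hA hb (le_sigmaMin A h)

theorem one_le_kappa [Nonempty n] {A : Matrix m n ℝ} (h : LinearIndependent ℝ A.col) :
    1 ≤ kappa A := by
  rw [kappa_eq, one_le_div (sigmaMin_pos h)]
  exact sigmaMin_le_norm A

end CondNumber

/-! ### Rounding errors of sums, inner products and matrix products -/

/-- Convexity in ε: on [0, 1] the power lies below its chord. This gives rounding constants
depending only on dimensions. -/
theorem one_add_pow_sub_one_le {ε : ℝ} (h0 : 0 ≤ ε) (h1 : ε ≤ 1) (n : ℕ) :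
    (1 + ε) ^ n - 1 ≤ (2 ^ n - 1) * ε := by
  induction n with
  | zero => simp
  | succ n ih =>
    have h2 : (1 : ℝ) ≤ 2 ^ n := one_le_pow₀ (by norm_num)
    calc (1 + ε) ^ (n + 1) - 1 = ((1 + ε) ^ n - 1) * (1 + ε) + ε := by ring
      _ ≤ ((2 ^ n - 1) * ε) * (1 + 1) + ε := by
          have : 0 ≤ (2 ^ n - 1) * ε := mul_nonneg (by linarith) h0
          nlinarith [ih, this]
      _ = (2 ^ (n + 1) - 1) * ε := by ring

theorem FlRound.abs_sub_le {ε e z : ℝ} (h : FlRound ε e z) : |z - e| ≤ ε * |e| := by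
  obtain ⟨δ, hδ, rfl⟩ := h
  have : e * (1 + δ) - e = δ * e := by ring
  rw [this, abs_mul]
  exact mul_le_mul_of_nonneg_right hδ (abs_nonneg e)

/-- A leaf passes through fewer roundings than the tree has leaves, whatever its shape. In the
induction, the other subtree is nonempty, which pays for the extra factor 1 + ε of the new root. -/
theorem FlSum.abs_sub_le {ι : Type} [DecidableEq ι] {ε : ℝ} (h0 : 0 ≤ ε) {t : ι → ℝ}
    {S : Finset ι} {z : ℝ} (h : FlSum ε t S z) :
    |z - ∑ i ∈ S, t i| ≤ ((1 + ε) ^ S.card - 1) * ∑ i ∈ S, |t i| := by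
  induction h with
  | empty => simp
  | single i => simp only [Finset.sum_singleton, sub_self, abs_zero]; simp; positivity
  | add S T a b z hS hT hST ha hb hz iha ihb =>
    rw [Finset.sum_union hST, Finset.sum_union hST, Finset.card_union_of_disjoint hST]
    set A := ∑ i ∈ S, t i
    set B := ∑ i ∈ T, t i
    set A' := ∑ i ∈ S, |t i|
    set B' := ∑ i ∈ T, |t i|
    have hA' : 0 ≤ A' := Finset.sum_nonneg fun _ _ => abs_nonneg _
    have hB' : 0 ≤ B' := Finset.sum_nonneg fun _ _ => abs_nonneg _
    have hA : |A| ≤ A' := Finset.abs_sum_le_sum_abs _ _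
    have hB : |B| ≤ B' := Finset.abs_sum_le_sum_abs _ _
    have hS1 : 1 ≤ S.card := hS.card_pos
    have hT1 : 1 ≤ T.card := hT.card_pos
    have hu : 1 ≤ 1 + ε := by linarith
    have hgS : (1 + ε) ^ S.card * (1 + ε) ≤ (1 + ε) ^ (S.card + T.card) := by
      rw [← pow_succ]; exact pow_le_pow_right₀ hu (by omega)
    have hgT : (1 + ε) ^ T.card * (1 + ε) ≤ (1 + ε) ^ (S.card + T.card) := by
      rw [← pow_succ]; exact pow_le_pow_right₀ hu (by omega)
    have ha1 : |a| ≤ (1 + ε) ^ S.card * A' := by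
      have := abs_add_le (a - A) A
      rw [sub_add_cancel] at this
      linarith
    have hb1 : |b| ≤ (1 + ε) ^ T.card * B' := by
      have := abs_add_le (b - B) B
      rw [sub_add_cancel] at this
      linarith
    have hz1 := hz.abs_sub_le
    have e1 : z - (A + B) = (z - (a + b)) + ((a - A) + (b - B)) := by ring
    calc |z - (A + B)| ≤ |z - (a + b)| + (|a - A| + |b - B|) := by
          rw [e1]
          exact (abs_add_le _ _).trans (by gcongr; exact abs_add_le _ _)
      _ ≤ ε * (|a| + |b|) + (|a - A| + |b - B|) := by
          have := mul_le_mul_of_nonneg_left (abs_add_le a b) h0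
          linarith
      _ ≤ ε * ((1 + ε) ^ S.card * A' + (1 + ε) ^ T.card * B') +
          (((1 + ε) ^ S.card - 1) * A' + ((1 + ε) ^ T.card - 1) * B') := by gcongr
      _ = ((1 + ε) ^ S.card * (1 + ε) - 1) * A' + ((1 + ε) ^ T.card * (1 + ε) - 1) * B' := by ring
      _ ≤ ((1 + ε) ^ (S.card + T.card) - 1) * A' + ((1 + ε) ^ (S.card + T.card) - 1) * B' := by
          gcongr
      _ = _ := by ring

theorem FlDot.abs_sub_le {ι : Type} [Fintype ι] [DecidableEq ι] {ε : ℝ} (h0 : 0 ≤ ε) (h1 : ε ≤ 1)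
    {x y : ι → ℝ} {z : ℝ} (h : FlDot ε x y z) :
    |z - ∑ i, x i * y i| ≤ 2 ^ (Fintype.card ι + 1) * ε * ∑ i, |x i * y i| := by
  obtain ⟨t, ht, hz⟩ := h
  have hz1 := hz.abs_sub_le h0
  rw [Finset.card_univ] at hz1
  set n := Fintype.card ι
  set W := ∑ i, |x i * y i|
  have hW : 0 ≤ W := Finset.sum_nonneg fun _ _ => abs_nonneg _
  have hu : 1 ≤ (1 + ε) ^ n := one_le_pow₀ (by linarith)
  have ht1 : |∑ i, t i - ∑ i, x i * y i| ≤ ε * W := by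
    rw [← Finset.sum_sub_distrib, Finset.mul_sum]
    exact (Finset.abs_sum_le_sum_abs _ _).trans (Finset.sum_le_sum fun i _ => (ht i).abs_sub_le)
  have ht2 : ∑ i, |t i| ≤ (1 + ε) * W := by
    rw [Finset.mul_sum]
    refine Finset.sum_le_sum fun i _ => ?_
    have h3 := (ht i).abs_sub_le
    have h4 := abs_add_le (t i - x i * y i) (x i * y i)
    rw [sub_add_cancel] at h4
    linarith
  calc |z - ∑ i, x i * y i| ≤ |z - ∑ i, t i| + |∑ i, t i - ∑ i, x i * y i| := _root_.abs_sub_le _ _ _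
    _ ≤ ((1 + ε) ^ n - 1) * ((1 + ε) * W) + ε * W := by
        have := mul_le_mul_of_nonneg_left ht2 (sub_nonneg.mpr hu)
        linarith
    _ = ((1 + ε) ^ (n + 1) - 1) * W := by ring
    _ ≤ ((2 ^ (n + 1) - 1) * ε) * W :=
        mul_le_mul_of_nonneg_right (one_add_pow_sub_one_le h0 h1 _) hW
    _ ≤ 2 ^ (n + 1) * ε * W := by
        have := mul_nonneg h0 hW
        linarith

/-- Entrywise error of a computed matrix product whose factors have entries bounded by `a` and
`b`. -/
theorem FlMatMul.abs_sub_le {l m n : Type} [Fintype m] [DecidableEq m] {ε : ℝ} (h0 : 0 ≤ ε)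
    (h1 : ε ≤ 1) {A : Matrix l m ℝ} {B : Matrix m n ℝ} {C : Matrix l n ℝ} (h : FlMatMul ε A B C)
    {a b : ℝ} (ha : 0 ≤ a) (hA : ∀ i k, |A i k| ≤ a) (hB : ∀ k j, |B k j| ≤ b) (i : l) (j : n) :
    |C i j - (A * B) i j| ≤ 2 ^ (Fintype.card m + 1) * ε * (Fintype.card m * (a * b)) := by
  refine ((h i j).abs_sub_le h0 h1).trans ?_
  refine mul_le_mul_of_nonneg_left ?_ (by positivity)
  calc ∑ k, |A i k * B k j| ≤ ∑ _k : m, a * b := Finset.sum_le_sum fun k _ => by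
        rw [abs_mul]
        exact mul_le_mul (hA i k) (hB k j) (abs_nonneg _) ha
    _ = _ := by simp

theorem abs_mul_apply_le {l m n : Type} [Fintype m] {A : Matrix l m ℝ} {B : Matrix m n ℝ}
    {a b : ℝ} (ha : 0 ≤ a) (hA : ∀ i k, |A i k| ≤ a) (hB : ∀ k j, |B k j| ≤ b) (i : l) (j : n) :
    |(A * B) i j| ≤ Fintype.card m * (a * b) := by
  calc |∑ k, A i k * B k j| ≤ ∑ k, |A i k * B k j| := Finset.abs_sum_le_sum_abs _ _
    _ ≤ ∑ _k : m, a * b := Finset.sum_le_sum fun k _ => by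
        rw [abs_mul]
        exact mul_le_mul (hA i k) (hB k j) (abs_nonneg _) ha
    _ = _ := by simp

/-! ### Block columns -/

section Blocks

variable {m p s : ℕ}

/-- The inclusion of the columns before the `k`-th block into all columns. -/
theorem prevIndex_injective (k : Fin p) : Function.Injective
    (fun c : {j : Fin p // j < k} × Fin s => ((c.1.1, c.2) : Fin p × Fin s)) := by
  rintro ⟨⟨j, hj⟩, a⟩ ⟨⟨j', hj'⟩, a'⟩ h
  simpa using h

theorem card_prevIndex_le (k : Fin p) :
    Fintype.card ({j : Fin p // j < k} × Fin s) ≤ p * s := by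
  simpa using Fintype.card_le_of_injective _ (prevIndex_injective (s := s) k)

theorem sum_block_split {M : Type*} [AddCommMonoid M] (g : Fin p × Fin s → M) (k : Fin p)
    (hg : ∀ j a, k < j → g (j, a) = 0) :
    ∑ c, g c = ∑ c : {j : Fin p // j < k} × Fin s, g (c.1.1, c.2) + ∑ a, g (k, a) := by
  rw [Fintype.sum_prod_type, Fintype.sum_prod_type,
    ← Fintype.sum_subtype_add_sum_subtype (fun j : Fin p => j < k)]
  congr 1
  refine Fintype.sum_eq_single (⟨k, lt_irrefl k⟩ : {j : Fin p // ¬ j < k}) fun j hj => ?_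
  refine Finset.sum_eq_zero fun a _ => hg _ a ?_
  exact lt_of_le_of_ne (not_lt.mp j.2) fun h => hj (Subtype.ext h.symm)

theorem norm_blockCol_le (X : Matrix (Fin m) (Fin p × Fin s) ℝ) (k : Fin p) :
    ‖blockCol X k‖ ≤ ‖X‖ :=
  norm_submatrix_id_le (f := fun a : Fin s => ((k, a) : Fin p × Fin s))
    (fun a b h => by simpa using h) X

/-- The block column of a product with a block upper triangular matrix. -/
theorem blockCol_mul (Q : Matrix (Fin m) (Fin p × Fin s) ℝ)
    (R : Matrix (Fin p × Fin s) (Fin p × Fin s) ℝ) (hR : ∀ j k : Fin p, k < j → block R j k = 0)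
    (k : Fin p) :
    blockCol (Q * R) k = prevCols Q k * prevRows R k + blockCol Q k * block R k k := by
  ext i b
  have hR' : ∀ j a, k < j → Q i (j, a) * R (j, a) (k, b) = 0 := fun j a hj => by
    have : block R j k a b = 0 := by rw [hR j k hj]; rfl
    rw [show R (j, a) (k, b) = 0 from this, mul_zero]
  exact sum_block_split (fun c => Q i c * R c (k, b)) k hR'

theorem prevCols_mul (Q : Matrix (Fin m) (Fin p × Fin s) ℝ)
    (R : Matrix (Fin p × Fin s) (Fin p × Fin s) ℝ) (hR : ∀ j k : Fin p, k < j → block R j k = 0)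
    (k : Fin p) :
    prevCols (Q * R) k = prevCols Q k *
      R.submatrix (fun c : {j : Fin p // j < k} × Fin s => ((c.1.1, c.2) : Fin p × Fin s))
        (fun c : {j : Fin p // j < k} × Fin s => ((c.1.1, c.2) : Fin p × Fin s)) := by
  ext i ⟨⟨l, hl⟩, b⟩
  have hR' : ∀ j a, l < j → Q i (j, a) * R (j, a) (l, b) = 0 := fun j a hj => by
    have : block R j l a b = 0 := by rw [hR j l hj]; rfl
    rw [show R (j, a) (l, b) = 0 from this, mul_zero]
  refine (sum_block_split (fun c => Q i c * R c (l, b)) k fun j a h => hR' j a (hl.trans h)).trans ?_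
  rw [Finset.sum_eq_zero (s := (Finset.univ : Finset (Fin s))) fun a _ => hR' k a hl, add_zero]
  rfl

/-- Padding by zeros after block `k` lets lower bounds for the whole of `X` be applied to its
leading blocks. -/
theorem mulVec_block_extend (X : Matrix (Fin m) (Fin p × Fin s) ℝ) (k : Fin p)
    (u : {j : Fin p // j < k} × Fin s → ℝ) (v : Fin s → ℝ) :
    ∃ w : Fin p × Fin s → ℝ, X *ᵥ w = prevCols X k *ᵥ u + blockCol X k *ᵥ v ∧
      euclNorm u ≤ euclNorm w ∧ euclNorm v ≤ euclNorm w := by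
  set w : Fin p × Fin s → ℝ := fun c =>
    if h : c.1 < k then u (⟨c.1, h⟩, c.2) else if c.1 = k then v c.2 else 0 with hw
  have hu : (fun c : {j : Fin p // j < k} × Fin s => w (c.1.1, c.2)) = u := by
    ext ⟨⟨j, hj⟩, a⟩
    simp [hw, hj]
  have hv : (fun a => w (k, a)) = v := by
    ext a
    simp [hw]
  refine ⟨w, ?_, ?_, ?_⟩
  · ext i
    refine (sum_block_split (fun c => X i c * w c) k fun j a hj => ?_).trans ?_
    · simp [hw, hj.not_gt, hj.ne']
    · conv_rhs => rw [← hu, ← hv]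
      rfl
  · conv_lhs => rw [← hu]
    exact euclNorm_comp_le (prevIndex_injective k) w
  · conv_lhs => rw [← hv]
    exact euclNorm_comp_le (f := fun a : Fin s => ((k, a) : Fin p × Fin s))
      (fun a b h => by simpa using h) w

theorem norm_prevCols_sq_le {Q : Matrix (Fin m) (Fin p × Fin s) ℝ} {k : Fin p}
    (hQ : ∀ j < k, ‖blockCol Q j‖ ^ 2 ≤ 2) : ‖prevCols Q k‖ ^ 2 ≤ 2 * ((p : ℝ) - 1) := by
  have hk : (k : ℝ) ≤ (p : ℝ) - 1 := by
    have : ((k : ℕ) : ℝ) + 1 ≤ p := by exact_mod_cast k.2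
    linarith
  have hk0 : (0 : ℝ) ≤ (k : ℕ) := Nat.cast_nonneg _
  -- For the transpose the squared norm of the image is the sum of the blockwise ones, each at most
  -- 2‖v‖². Blocks are numbered from 0, so exactly `k` of them precede block `k`.
  have h : ‖(prevCols Q k)ᵀ‖ ≤ √(2 * k) := by
    refine norm_le_of_euclNorm_mulVec_le _ (Real.sqrt_nonneg _) fun v => ?_
    refine le_of_sq_le_sq ?_ (mul_nonneg (Real.sqrt_nonneg _) (euclNorm_nonneg _))
    rw [mul_pow, Real.sq_sqrt (by positivity), euclNorm_sq, Fintype.sum_prod_type]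
    have hj : ∀ j : {j : Fin p // j < k},
        ∑ a, ((prevCols Q k)ᵀ *ᵥ v) (j, a) ^ 2 ≤ 2 * euclNorm v ^ 2 := fun j => by
      have h1 : ∑ a, ((prevCols Q k)ᵀ *ᵥ v) (j, a) ^ 2 = euclNorm ((blockCol Q j)ᵀ *ᵥ v) ^ 2 := by
        rw [euclNorm_sq]; rfl
      rw [h1]
      refine (pow_le_pow_left₀ (euclNorm_nonneg _) (euclNorm_mulVec_le _ v) 2).trans ?_
      rw [mul_pow, norm_transpose_eq]
      exact mul_le_mul_of_nonneg_right (hQ j j.2) (sq_nonneg _)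
    refine (Finset.sum_le_sum fun j _ => hj j).trans (le_of_eq ?_)
    have hcard : Fintype.card {j : Fin p // j < k} = k := by
      rw [Fintype.card_subtype, ← Fin.card_Iio k]
      congr 1
      ext j
      simp
    rw [Finset.sum_const, Finset.card_univ, hcard, nsmul_eq_mul]
    ring
  rw [norm_transpose_eq] at h
  calc ‖prevCols Q k‖ ^ 2 ≤ √(2 * k) ^ 2 := pow_le_pow_left₀ (norm_nonneg _) h 2
    _ = 2 * k := Real.sq_sqrt (by positivity)
    _ ≤ _ := by linarith

theorem norm_sub_prevCols_mul_transpose_mul_le {X Q : Matrix (Fin m) (Fin p × Fin s) ℝ}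
    {k : Fin p} (hQ : ∀ j < k, ‖blockCol Q j‖ ^ 2 ≤ 2) :
    ‖blockCol X k - prevCols Q k * ((prevCols Q k)ᵀ * blockCol X k)‖ ≤
      (2 * (p : ℝ) - 1) * ‖X‖ := by
  have h1 := norm_prevCols_sq_le hQ
  have h2 : ‖prevCols Q k * ((prevCols Q k)ᵀ * blockCol X k)‖ ≤ ‖prevCols Q k‖ ^ 2 * ‖X‖ := by
    refine (Matrix.l2_opNorm_mul _ _).trans ?_
    rw [sq, mul_assoc]
    refine mul_le_mul_of_nonneg_left ?_ (norm_nonneg _)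
    refine (Matrix.l2_opNorm_mul _ _).trans ?_
    rw [norm_transpose_eq]
    exact mul_le_mul_of_nonneg_left (norm_blockCol_le X k) (norm_nonneg _)
  have h3 := mul_le_mul_of_nonneg_right h1 (norm_nonneg X)
  have h4 := norm_sub_le (blockCol X k) (prevCols Q k * ((prevCols Q k)ᵀ * blockCol X k))
  have h5 := norm_blockCol_le X k
  linarith

/-- A matrix whose blocks before the `k`-th are small. -/
theorem norm_prevCols_le {D : Matrix (Fin m) (Fin p × Fin s) ℝ} {k : Fin p} {d : ℝ} (hd : 0 ≤ d)
    (hD : ∀ j < k, ‖blockCol D j‖ ≤ d) : ‖prevCols D k‖ ≤ m * (p * s) * d := by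
  refine (norm_le_of_abs_apply_le (prevCols D k) hd fun i c => ?_).trans ?_
  · exact (abs_apply_le_norm (blockCol D c.1) i c.2).trans (hD c.1 c.1.2)
  · have := card_prevIndex_le (s := s) k
    have h : (Fintype.card ({j : Fin p // j < k} × Fin s) : ℝ) ≤ p * s := by exact_mod_cast this
    rw [Fintype.card_fin]
    gcongr

theorem norm_le_of_norm_blockCol_le {D : Matrix (Fin m) (Fin p × Fin s) ℝ} {d : ℝ} (hd : 0 ≤ d)
    (hD : ∀ j, ‖blockCol D j‖ ≤ d) : ‖D‖ ≤ m * (p * s) * d := by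
  refine (norm_le_of_abs_apply_le D hd fun i c => ?_).trans (by simp)
  exact (abs_apply_le_norm (blockCol D c.1) i c.2).trans (hD c.1)

/-- If `[X_1, …, X_{k-1}] + D = Q_{k-1} R` for a block upper triangular `R` and `V` is close to
`X_k - Q_{k-1} R_{1:k-1,k}`, then `V` is bounded below like `X`. -/
theorem lower_bound_of_residual {X Q : Matrix (Fin m) (Fin p × Fin s) ℝ}
    {R : Matrix (Fin p × Fin s) (Fin p × Fin s) ℝ} (hR : ∀ j k : Fin p, k < j → block R j k = 0)
    {k : Fin p} {V : Matrix (Fin m) (Fin s) ℝ} {σ : ℝ} (hσ : 0 < σ)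
    (hX : ∀ w, σ * euclNorm w ≤ euclNorm (X *ᵥ w))
    (hD : ‖prevCols (Q * R - X) k‖ ≤ σ / 4)
    (hV : ‖V - (blockCol X k - prevCols Q k * prevRows R k)‖ ≤ σ / 4) (v : Fin s → ℝ) :
    σ / 2 * euclNorm v ≤ euclNorm (V *ᵥ v) := by
  set D := prevCols (Q * R - X) k with hDdef
  set G := V - (blockCol X k - prevCols Q k * prevRows R k) with hG
  set ι := fun c : {j : Fin p // j < k} × Fin s => ((c.1.1, c.2) : Fin p × Fin s) with hι
  have hQR : prevCols Q k * R.submatrix ι ι = prevCols X k + D := by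
    rw [← prevCols_mul Q R hR k]
    ext i c
    simp [hDdef, prevCols]
  -- A kernel vector y would satisfy Xy = -Dy on the leading blocks, hence σ‖y‖ ≤ (σ/4)‖y‖.
  have hinj : Function.Injective (R.submatrix ι ι).mulVec := by
    intro u u' huu
    refine sub_eq_zero.mp ?_
    set y := u - u'
    have hy : R.submatrix ι ι *ᵥ y = 0 := by
      rw [Matrix.mulVec_sub, sub_eq_zero]; exact huu
    have h0 : prevCols X k *ᵥ y = -(D *ᵥ y) := by
      rw [eq_neg_iff_add_eq_zero, ← Matrix.add_mulVec, ← hQR, ← Matrix.mulVec_mulVec, hy,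
        Matrix.mulVec_zero]
    obtain ⟨w, hw, hyw, -⟩ := mulVec_block_extend X k y 0
    have h1 := hX w
    rw [hw, Matrix.mulVec_zero, add_zero, h0, euclNorm_neg] at h1
    have h2 := euclNorm_mulVec_le D y
    have h3 := mul_le_mul_of_nonneg_right hD (euclNorm_nonneg y)
    have h4 := mul_le_mul_of_nonneg_left hyw hσ.le
    exact euclNorm_eq_zero.mp (le_antisymm (by nlinarith) (euclNorm_nonneg y))
  obtain ⟨u, hu⟩ : ∃ u, R.submatrix ι ι *ᵥ u = prevRows R k *ᵥ v :=
    (LinearMap.injective_iff_surjective (f := (R.submatrix ι ι).mulVecLin)).mp hinj _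
  -- With w = (-u, v, 0), the projected part is absorbed into X w. The errors D u and G v cost at
  -- most a quarter of σ‖w‖ each, leaving σ/2.
  obtain ⟨w, hw, huw, hvw⟩ := mulVec_block_extend X k (-u) v
  have hVv : V *ᵥ v = X *ᵥ w - D *ᵥ u + G *ᵥ v := by
    have h1 : prevCols Q k *ᵥ (prevRows R k *ᵥ v) = prevCols X k *ᵥ u + D *ᵥ u := by
      rw [← hu, Matrix.mulVec_mulVec, hQR, Matrix.add_mulVec]
    rw [hw, hG, Matrix.sub_mulVec, Matrix.sub_mulVec, ← Matrix.mulVec_mulVec, h1,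
      Matrix.mulVec_neg]
    abel
  have hXw : X *ᵥ w = V *ᵥ v + D *ᵥ u - G *ᵥ v := by rw [hVv]; abel
  rw [euclNorm_neg] at huw
  have h1 := hX w
  have h2 : euclNorm (X *ᵥ w) ≤ euclNorm (V *ᵥ v) + euclNorm (D *ᵥ u) + euclNorm (G *ᵥ v) := by
    rw [hXw]
    exact (euclNorm_sub_le _ _).trans (by gcongr; exact euclNorm_add_le _ _)
  have h3 := (euclNorm_mulVec_le D u).trans
    (mul_le_mul hD huw (euclNorm_nonneg u) (by positivity))
  have h4 := (euclNorm_mulVec_le G v).trans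
    (mul_le_mul hV hvw (euclNorm_nonneg v) (by positivity))
  have h5 := mul_le_mul_of_nonneg_left hvw (half_pos hσ).le
  linarith

theorem norm_le_div_of_lower_bound {l n : Type} [Fintype l] [Fintype n] [DecidableEq n]
    {A : Matrix n n ℝ} {c : ℝ} (hc : 0 < c) (hA : ∀ v, c * euclNorm v ≤ euclNorm (A *ᵥ v))
    (B : Matrix l n ℝ) : ‖B‖ ≤ ‖B * A‖ / c := by
  refine norm_le_of_euclNorm_mulVec_le _ (by positivity) fun v => ?_
  have hinj := Matrix.mulVec_injective_iff.mpr (linearIndependent_col_of_lower_bound hc hA)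
  obtain ⟨z, rfl⟩ := (LinearMap.injective_iff_surjective (f := A.mulVecLin)).mp hinj v
  rw [Matrix.mulVecLin_apply, Matrix.mulVec_mulVec]
  refine (euclNorm_mulVec_le _ z).trans ?_
  rw [div_mul_eq_mul_div, le_div_iff₀ hc, mul_assoc, mul_comm _ c]
  exact mul_le_mul_of_nonneg_left (hA z) (norm_nonneg _)

end Blocks

/-! ### One step of BCGS-A -/

/-- Rounding errors in the projection step, in terms of `ε ‖X‖`. -/
theorem exists_projection_error_bound (m p s : ℕ) :
    ∃ f : ℝ, 0 ≤ f ∧ ∀ (ε : ℝ) (ioA io : Intraortho m s)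
      (X Q : Matrix (Fin m) (Fin p × Fin s) ℝ) (R : Matrix (Fin p × Fin s) (Fin p × Fin s) ℝ)
      (k : Fin p), 0 ≤ ε → ε ≤ 1 → IsComputedBCGSA ε ioA io X Q R → 0 < k.val →
      (∀ j < k, ‖blockCol Q j‖ ^ 2 ≤ 2) →
      ∃ V : Matrix (Fin m) (Fin s) ℝ, (blockCol Q k, block R k k) = io V ∧
        ‖V - (blockCol X k - prevCols Q k * prevRows R k)‖ ≤ f * ε * ‖X‖ ∧
        ‖V - (blockCol X k - prevCols Q k * ((prevCols Q k)ᵀ * blockCol X k))‖ ≤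
          f * ε * ‖X‖ := by
  set N : ℝ := p * s with hN
  have hN0 : 0 ≤ N := by positivity
  -- In units of ε‖X‖, `e₀`, `e₁` and `e₂` bound the entrywise errors of the computed R_{1:k-1,k}, P
  -- and V; `r`‖X‖ bounds the entries of R_{1:k-1,k}. The factors 2 bound the entries of Q. The
  -- bracket in `e₂` accounts for rounding the subtraction.
  set e₀ : ℝ := 2 ^ (m + 1) * (m * 2) with he₀
  set r : ℝ := m * 2 + e₀ with hr
  set e₁ : ℝ := 2 ^ (p * s + 1) * (N * (2 * r)) with he₁
  set e₂ : ℝ := e₁ + (1 + N * (2 * r) + e₁) with he₂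
  have hr0 : 0 ≤ r := by positivity
  refine ⟨m * s * (e₂ + N * (2 * e₀)), by positivity, ?_⟩
  intro ε ioA io X Q R k h0 h1 hcomp hk hQ
  obtain ⟨P, V, hP, hV, hio⟩ := hcomp.ortho k hk
  set x := ‖X‖
  have hx : 0 ≤ x := norm_nonneg X
  have hcard : (Fintype.card ({j : Fin p // j < k} × Fin s) : ℝ) ≤ N := by
    rw [hN]
    exact_mod_cast card_prevIndex_le (s := s) k
  have hcardpow : (2 : ℝ) ^ (Fintype.card ({j : Fin p // j < k} × Fin s) + 1) ≤
      2 ^ (p * s + 1) :=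
    pow_le_pow_right₀ (by norm_num) (Nat.succ_le_succ (card_prevIndex_le (s := s) k))
  have hQe : ∀ i c, |prevCols Q k i c| ≤ 2 := fun i c => by
    have h2 := hQ c.1 c.1.2
    have h3 := abs_apply_le_norm (blockCol Q c.1) i c.2
    exact h3.trans (by nlinarith [norm_nonneg (blockCol Q c.1)])
  have hQe' : ∀ c i, |(prevCols Q k)ᵀ c i| ≤ 2 := fun c i => hQe i c
  have hXe : ∀ i b, |blockCol X k i b| ≤ x := fun i b => abs_apply_le_norm X i (k, b)
  have hS : ∀ c b, |prevRows R k c b - ((prevCols Q k)ᵀ * blockCol X k) c b| ≤ e₀ * ε * x :=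
    fun c b => by
      have := FlMatMul.abs_sub_le h0 h1 (hcomp.proj k hk) zero_le_two hQe' hXe c b
      rw [Fintype.card_fin] at this
      exact this.trans (le_of_eq (by rw [he₀]; ring))
  have hSe : ∀ c b, |prevRows R k c b| ≤ r * x := fun c b => by
    have h2 := abs_mul_apply_le zero_le_two hQe' hXe c b
    rw [Fintype.card_fin] at h2
    have h3 := abs_add_le (prevRows R k c b - ((prevCols Q k)ᵀ * blockCol X k) c b)
      (((prevCols Q k)ᵀ * blockCol X k) c b)
    rw [sub_add_cancel] at h3
    have h4 : e₀ * ε * x ≤ e₀ * 1 * x := by gcongr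
    have h5 := hS c b
    rw [hr]
    linarith
  have hPe : ∀ i b, |P i b - (prevCols Q k * prevRows R k) i b| ≤ e₁ * ε * x := fun i b => by
    refine (FlMatMul.abs_sub_le h0 h1 hP zero_le_two hQe hSe i b).trans ?_
    calc _ ≤ 2 ^ (p * s + 1) * ε * (N * (2 * (r * x))) := by gcongr
      _ = e₁ * ε * x := by rw [he₁]; ring
  have hQS : ∀ i b, |(prevCols Q k * prevRows R k) i b| ≤ N * (2 * r) * x := fun i b => by
    refine (abs_mul_apply_le zero_le_two hQe hSe i b).trans ?_
    calc _ ≤ N * (2 * (r * x)) := by gcongr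
      _ = _ := by ring
  have hVe : ∀ i b, |(V - (blockCol X k - prevCols Q k * prevRows R k)) i b| ≤ e₂ * ε * x :=
    fun i b => by
      have h2 := (hV i b).abs_sub_le
      have h3 := hPe i b
      have h4 : |blockCol X k i b - P i b| ≤ (1 + N * (2 * r) + e₁) * x := by
        have h5 : blockCol X k i b - P i b = blockCol X k i b +
            (-(prevCols Q k * prevRows R k) i b + -(P i b - (prevCols Q k * prevRows R k) i b)) := by
          ring
        have h6 : e₁ * ε * x ≤ e₁ * 1 * x := by gcongr
        rw [h5]
        refine (abs_add_le _ _).trans ?_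
        have h7 := abs_add_le (-(prevCols Q k * prevRows R k) i b)
          (-(P i b - (prevCols Q k * prevRows R k) i b))
        rw [abs_neg, abs_neg] at h7
        linarith [hXe i b, hQS i b]
      have h5 := mul_le_mul_of_nonneg_left h4 h0
      have h6 : (V - (blockCol X k - prevCols Q k * prevRows R k)) i b =
          (V i b - (blockCol X k i b - P i b)) + -(P i b - (prevCols Q k * prevRows R k) i b) := by
        simp only [Matrix.sub_apply]; ring
      rw [h6]
      refine (abs_add_le _ _).trans ?_
      rw [abs_neg, he₂]
      linarith
  refine ⟨V, hio, ?_, ?_⟩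
  · refine (norm_le_of_abs_apply_le _ (by positivity) hVe).trans ?_
    rw [Fintype.card_fin, Fintype.card_fin]
    calc (m : ℝ) * s * (e₂ * ε * x) ≤ m * s * ((e₂ + N * (2 * e₀)) * ε * x) := by
          gcongr
          have : 0 ≤ N * (2 * e₀) := by positivity
          linarith
      _ = _ := by ring
  · have hall : ∀ i b, |(V - (blockCol X k - prevCols Q k * ((prevCols Q k)ᵀ * blockCol X k))) i b|
        ≤ (e₂ + N * (2 * e₀)) * ε * x := fun i b => by
      have h2 : (V - (blockCol X k - prevCols Q k * ((prevCols Q k)ᵀ * blockCol X k))) i b =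
          (V - (blockCol X k - prevCols Q k * prevRows R k)) i b + -(prevCols Q k *
            (prevRows R k - (prevCols Q k)ᵀ * blockCol X k)) i b := by
        rw [Matrix.mul_sub]
        simp only [Matrix.sub_apply]
        ring
      have h3 : |(prevCols Q k * (prevRows R k - (prevCols Q k)ᵀ * blockCol X k)) i b| ≤
          N * (2 * (e₀ * ε * x)) := by
        refine (abs_mul_apply_le zero_le_two hQe hS i b).trans ?_
        gcongr
      rw [h2]
      refine (abs_add_le _ _).trans ?_
      rw [abs_neg]
      linarith [hVe i b]
    refine (norm_le_of_abs_apply_le _ (by positivity) hall).trans (le_of_eq ?_)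
    rw [Fintype.card_fin, Fintype.card_fin]
    ring

/-- What holds after the `k`-th step of BCGS-A: the block `Q_k` is nearly orthonormal, the residual
of the `k`-th block column is small, and, unless `k` is the first block, `Q_k R_kk` is close to
`X_k - Q_{k-1} Q_{k-1}ᵀ X_k` and has full rank. -/
structure StepBounds {m p s : ℕ} (ε c αA α C₁ : ℝ) (X Q : Matrix (Fin m) (Fin p × Fin s) ℝ)
    (R : Matrix (Fin p × Fin s) (Fin p × Fin s) ℝ) (k : Fin p) : Prop where
  lt_one : ‖1 - (blockCol Q k)ᵀ * blockCol Q k‖ < 1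
  residual : ‖blockCol (Q * R - X) k‖ ≤ C₁ * ε * ‖X‖
  first : k.val = 0 → ‖1 - (blockCol Q k)ᵀ * blockCol Q k‖ ≤ c * ε * kappa X ^ αA
  succ : 0 < k.val → ‖1 - (blockCol Q k)ᵀ * blockCol Q k‖ ≤ c * ε * (4 * p * kappa X) ^ α
  close : 0 < k.val → ‖blockCol Q k * block R k k -
    (blockCol X k - prevCols Q k * ((prevCols Q k)ᵀ * blockCol X k))‖ ≤ C₁ * ε * ‖X‖
  lower_bound : 0 < k.val → ∀ v,
    sigmaMin X / 4 * euclNorm v ≤ euclNorm ((blockCol Q k * block R k k) *ᵥ v)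

theorem StepBounds.norm_sq_le {m p s : ℕ} {ε c αA α C₁ : ℝ}
    {X Q : Matrix (Fin m) (Fin p × Fin s) ℝ} {R : Matrix (Fin p × Fin s) (Fin p × Fin s) ℝ}
    {k : Fin p} (h : StepBounds ε c αA α C₁ X Q R k) : ‖blockCol Q k‖ ^ 2 ≤ 2 :=
  norm_sq_le_two_of_norm_one_sub_lt _ h.lt_one

theorem stepBounds_of_val_eq_zero {m p s : ℕ} [NeZero s] {ε c αA α C₁ : ℝ}
    (hαA : 0 ≤ αA) (hc : 0 ≤ c) (hC₁ : c ≤ C₁) {ioA io : Intraortho m s}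
    {X Q : Matrix (Fin m) (Fin p × Fin s) ℝ} {R : Matrix (Fin p × Fin s) (Fin p × Fin s) ℝ}
    (hε : 0 ≤ ε) (hX : LinearIndependent ℝ X.col) (hioA : IntraorthoBounds ε c αA (kappa X) ioA)
    (hcomp : IsComputedBCGSA ε ioA io X Q R) {k : Fin p} (hk : k.val = 0) :
    StepBounds ε c αA α C₁ X Q R k := by
  have : Nonempty (Fin p) := ⟨k⟩
  have hσ := sigmaMin_pos hX
  have hlow : ∀ v, sigmaMin X * euclNorm v ≤ euclNorm (blockCol X k *ᵥ v) := fun v => by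
    obtain ⟨w, hw, -, hv⟩ := mulVec_block_extend X k 0 v
    rw [Matrix.mulVec_zero, zero_add] at hw
    rw [← hw]
    exact (mul_le_mul_of_nonneg_left hv hσ.le).trans (sigmaMin_mul_euclNorm_le X w)
  have hli := linearIndependent_col_of_lower_bound hσ hlow
  have hκ : kappa (blockCol X k) ≤ kappa X := by
    rw [kappa_eq X]
    exact kappa_le_of hσ (norm_blockCol_le X k) hlow
  obtain ⟨⟨ΔX, hΔ, hΔn⟩, horth, hlt⟩ := hioA _ hli hκ
  rw [← hcomp.first k hk] at hΔ horth hlt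
  refine ⟨hlt, ?_, fun _ => horth.trans ?_, fun h => by omega, fun h => by omega,
    fun h => by omega⟩
  · have h1 : prevCols Q k * prevRows R k = 0 := by
      ext i b
      refine Finset.sum_eq_zero fun c _ => ?_
      have := Fin.lt_def.mp c.1.2
      omega
    have h2 : blockCol (Q * R - X) k = ΔX := by
      have h3 : blockCol (Q * R - X) k = blockCol (Q * R) k - blockCol X k := rfl
      rw [h3, blockCol_mul Q R hcomp.lower, h1, zero_add, ← hΔ, add_sub_cancel_left]
    rw [h2]
    refine hΔn.trans ?_
    have h3 := norm_blockCol_le X k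
    have hC0 : 0 ≤ C₁ := hc.trans hC₁
    gcongr
  · have := one_le_kappa hli
    gcongr

/-- `hV1`, relative to the computed coefficients, serves the residual and the lower bound on V;
`hV2`, relative to the exact projection, serves ‖V‖ and `close`. -/
theorem stepBounds_of_forall_lt {m p s : ℕ} [NeZero s] {ε c αA α f C₁ : ℝ} (hα : 0 ≤ α)
    (hc : 0 ≤ c) (hf : 0 ≤ f) (hC₁ : f + 2 * p * c ≤ C₁) {io : Intraortho m s}
    {X Q : Matrix (Fin m) (Fin p × Fin s) ℝ} {R : Matrix (Fin p × Fin s) (Fin p × Fin s) ℝ}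
    (hε : 0 ≤ ε) (hX : LinearIndependent ℝ X.col)
    (hio : IntraorthoBounds ε c α (4 * p * kappa X) io)
    (hR : ∀ j k : Fin p, k < j → block R j k = 0)
    {k : Fin p} (hk : 0 < k.val) (hprev : ∀ j < k, StepBounds ε c αA α C₁ X Q R j)
    {V : Matrix (Fin m) (Fin s) ℝ} (hV : (blockCol Q k, block R k k) = io V)
    (hV1 : ‖V - (blockCol X k - prevCols Q k * prevRows R k)‖ ≤ f * ε * ‖X‖)
    (hV2 : ‖V - (blockCol X k - prevCols Q k * ((prevCols Q k)ᵀ * blockCol X k))‖ ≤ f * ε * ‖X‖)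
    (hs1 : m * (p * s) * C₁ * (ε * kappa X) ≤ 1 / 4) (hs2 : f * (ε * kappa X) ≤ 1 / 4)
    (hs3 : 2 * p * c * (ε * kappa X) ≤ 1 / 4) :
    StepBounds ε c αA α C₁ X Q R k := by
  have : Nonempty (Fin p) := ⟨k⟩
  set σ := sigmaMin X with hσdef
  set x := ‖X‖ with hx
  have hσ : 0 < σ := sigmaMin_pos hX
  have hx0 : 0 ≤ x := norm_nonneg X
  have hκ : x = kappa X * σ := by rw [kappa_eq X, div_mul_cancel₀ _ hσ.ne']
  have hκ1 : 1 ≤ kappa X := one_le_kappa hX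
  have hp : (1 : ℝ) ≤ p := by exact_mod_cast k.pos
  have hC0 : 0 ≤ C₁ := le_trans (by positivity) hC₁
  -- Since ‖X‖ = κ(X)σ, smallness of εκ(X) turns errors relative to ‖X‖ into fractions of σ_min(X).
  have scale : ∀ a : ℝ, a * (ε * kappa X) ≤ 1 / 4 → a * ε * x ≤ σ / 4 := fun a ha => by
    rw [hκ]
    have := mul_le_mul_of_nonneg_right ha hσ.le
    linarith
  have hfx : f * ε * x ≤ x / 4 := by
    have h1 : f * ε * 1 ≤ f * ε * kappa X := by gcongr
    have h2 : f * ε ≤ 1 / 4 := by linarith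
    have := mul_le_mul_of_nonneg_right h2 hx0
    linarith
  have hlow : ∀ v, σ / 2 * euclNorm v ≤ euclNorm (V *ᵥ v) := by
    refine lower_bound_of_residual hR hσ (sigmaMin_mul_euclNorm_le X) ?_
      (hV1.trans (scale _ hs2))
    refine (norm_prevCols_le (d := C₁ * ε * x) (by positivity)
      fun j hj => (hprev j hj).residual).trans ?_
    have := scale _ hs1
    linarith
  -- The exact projection contributes 2p - 1 and the rounding errors at most 1/4.
  have hVn : ‖V‖ ≤ (2 * p - 1 / 2) * x := by
    have h1 := norm_sub_prevCols_mul_transpose_mul_le (X := X) fun j hj => (hprev j hj).norm_sq_le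
    have h2 := norm_add_le (V - (blockCol X k - prevCols Q k * ((prevCols Q k)ᵀ * blockCol X k)))
      (blockCol X k - prevCols Q k * ((prevCols Q k)ᵀ * blockCol X k))
    rw [sub_add_cancel] at h2
    linarith
  have hli := linearIndependent_col_of_lower_bound (half_pos hσ) hlow
  have hκV : kappa V ≤ 4 * p * kappa X := by
    refine (kappa_le_of (half_pos hσ) hVn hlow).trans ?_
    rw [div_le_iff₀ (half_pos hσ)]
    have : 4 * p * kappa X * (σ / 2) = 2 * p * x := by rw [hκ]; ring
    rw [this]
    linarith
  obtain ⟨⟨ΔV, hΔ, hΔn⟩, horth, hlt⟩ := hio V hli hκV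
  rw [← hV] at hΔ horth hlt
  have hΔn' : ‖ΔV‖ ≤ 2 * p * c * ε * x := by
    refine hΔn.trans ?_
    have h1 : ‖V‖ ≤ 2 * p * x := by linarith
    calc c * ε * ‖V‖ ≤ c * ε * (2 * p * x) := by gcongr
      _ = _ := by ring
  have hsum : f * ε * x + 2 * p * c * ε * x ≤ C₁ * ε * x := by
    have := mul_le_mul_of_nonneg_right hC₁ (mul_nonneg hε hx0)
    linarith
  refine ⟨hlt, ?_, fun h => by omega, fun _ => horth.trans ?_, fun _ => ?_, fun _ v => ?_⟩
  · have h3 : blockCol (Q * R - X) k = blockCol (Q * R) k - blockCol X k := rfl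
    have h4 : blockCol (Q * R - X) k =
        (V - (blockCol X k - prevCols Q k * prevRows R k)) + ΔV := by
      rw [h3, blockCol_mul Q R hR, ← hΔ]
      abel
    rw [h4]
    exact (norm_add_le _ _).trans (by linarith)
  · have := one_le_kappa hli
    gcongr
  · have h4 : blockCol Q k * block R k k -
        (blockCol X k - prevCols Q k * ((prevCols Q k)ᵀ * blockCol X k)) =
        (V - (blockCol X k - prevCols Q k * ((prevCols Q k)ᵀ * blockCol X k))) + ΔV := by
      rw [← hΔ]
      abel
    rw [h4]
    exact (norm_add_le _ _).trans (by linarith)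
  · rw [← hΔ]
    have h1 : V *ᵥ v = (V + ΔV) *ᵥ v - ΔV *ᵥ v := by rw [Matrix.add_mulVec]; abel
    have h2 := hlow v
    rw [h1] at h2
    have h3 := euclNorm_sub_le ((V + ΔV) *ᵥ v) (ΔV *ᵥ v)
    have h4 := euclNorm_mulVec_le ΔV v
    have h5 := mul_le_mul_of_nonneg_right (hΔn'.trans (scale _ hs3)) (euclNorm_nonneg v)
    linarith

/-! ### Loss of orthogonality -/

/-- The new block is nearly orthogonal to the previous ones; the loss of orthogonality `ω` of the
previous blocks is amplified by at most a multiple of `κ(X)`. -/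
theorem norm_prevCols_transpose_mul_blockCol_le {m p s : ℕ} [NeZero s] {ε c αA α C₁ ω : ℝ}
    {X Q : Matrix (Fin m) (Fin p × Fin s) ℝ} {R : Matrix (Fin p × Fin s) (Fin p × Fin s) ℝ}
    (hX : LinearIndependent ℝ X.col) {k : Fin p} (hk : 0 < k.val)
    (h : ∀ j ≤ k, StepBounds ε c αA α C₁ X Q R j)
    (hω : ‖1 - (prevCols Q k)ᵀ * prevCols Q k‖ ≤ ω) :
    ‖(prevCols Q k)ᵀ * blockCol Q k‖ ≤ 16 * p * (C₁ * ε + ω) * kappa X := by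
  have : Nonempty (Fin p) := ⟨k⟩
  set σ := sigmaMin X with hσdef
  have hσ : 0 < σ := sigmaMin_pos hX
  have hp : (1 : ℝ) ≤ p := by exact_mod_cast k.pos
  have hω0 : 0 ≤ ω := (norm_nonneg _).trans hω
  have hκ : kappa X = ‖X‖ / σ := kappa_eq X
  have hQp : ‖prevCols Q k‖ ≤ 2 * p := by
    have := norm_prevCols_sq_le (Q := Q) (k := k) fun j hj => (h j hj.le).norm_sq_le
    nlinarith [norm_nonneg (prevCols Q k)]
  have hQk : ‖blockCol Q k‖ ≤ 2 := by
    have := (h k le_rfl).norm_sq_le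
    nlinarith [norm_nonneg (blockCol Q k)]
  -- Dividing the lower bound σ/4 for Q_k R_kk by ‖Q_k‖ ≤ 2. Together with ‖Q_{k-1}‖ ≤ 2p this
  -- produces the constant 16p.
  have hlow : ∀ v, σ / 8 * euclNorm v ≤ euclNorm (block R k k *ᵥ v) := fun v => by
    have h1 := (h k le_rfl).lower_bound hk v
    rw [← Matrix.mulVec_mulVec] at h1
    have h2 := h1.trans (euclNorm_mulVec_le (blockCol Q k) _)
    have h3 := mul_le_mul_of_nonneg_right hQk (euclNorm_nonneg (block R k k *ᵥ v))
    linarith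
  set E := blockCol Q k * block R k k -
    (blockCol X k - prevCols Q k * ((prevCols Q k)ᵀ * blockCol X k)) with hE
  have hEn : ‖E‖ ≤ C₁ * ε * ‖X‖ := (h k le_rfl).close hk
  have hprod : (prevCols Q k)ᵀ * blockCol Q k * block R k k = (prevCols Q k)ᵀ * E +
      (1 - (prevCols Q k)ᵀ * prevCols Q k) * ((prevCols Q k)ᵀ * blockCol X k) := by
    rw [hE, Matrix.mul_sub, Matrix.mul_sub, Matrix.sub_mul, Matrix.one_mul]
    simp only [Matrix.mul_assoc]
    abel
  have h1 : ‖(prevCols Q k)ᵀ * E‖ ≤ 2 * p * (C₁ * ε * ‖X‖) := by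
    refine (Matrix.l2_opNorm_mul _ _).trans ?_
    rw [norm_transpose_eq]
    gcongr
  have h2 : ‖(1 - (prevCols Q k)ᵀ * prevCols Q k) * ((prevCols Q k)ᵀ * blockCol X k)‖ ≤
      ω * (2 * p * ‖X‖) := by
    refine (Matrix.l2_opNorm_mul _ _).trans (mul_le_mul hω ?_ (norm_nonneg _) hω0)
    refine (Matrix.l2_opNorm_mul _ _).trans ?_
    rw [norm_transpose_eq]
    have := norm_blockCol_le X k
    gcongr
  refine (norm_le_div_of_lower_bound (by positivity) hlow _).trans ?_
  rw [div_le_iff₀ (by positivity), hprod, hκ]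
  refine (norm_add_le _ _).trans ((add_le_add h1 h2).trans (le_of_eq ?_))
  field_simp
  ring

theorem one_sub_transpose_mul_apply_comm {m n : Type} [Fintype m] [DecidableEq n]
    (Q : Matrix m n ℝ) (c d : n) : (1 - Qᵀ * Q : Matrix _ _ ℝ) c d = (1 - Qᵀ * Q : Matrix _ _ ℝ) d c := by
  have h : (1 - Qᵀ * Q)ᵀ = 1 - Qᵀ * Q := by simp
  exact congrFun (congrFun h d) c

theorem one_sub_transpose_mul_submatrix {m n l : Type} [Fintype m] [DecidableEq n] [DecidableEq l]
    (Q : Matrix m n ℝ) {f : l → n} (hf : Function.Injective f) (a b : l) :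
    (1 - (Q.submatrix id f)ᵀ * Q.submatrix id f : Matrix _ _ ℝ) a b = (1 - Qᵀ * Q : Matrix _ _ ℝ) (f a) (f b) := by
  have h1 : (1 : Matrix l l ℝ) a b = (1 : Matrix n n ℝ) (f a) (f b) := by
    simp [Matrix.one_apply, hf.eq_iff]
  rw [Matrix.sub_apply, Matrix.sub_apply, h1]
  rfl

/-- Growth of the loss of orthogonality from block to block. -/
theorem abs_one_sub_transpose_mul_apply_le {m p s : ℕ} [NeZero s] {ε c αA α C₁ A μ : ℝ}
    {X Q : Matrix (Fin m) (Fin p × Fin s) ℝ} {R : Matrix (Fin p × Fin s) (Fin p × Fin s) ℝ}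
    (hε : 0 ≤ ε) (hX : LinearIndependent ℝ X.col)
    (hαA : 0 ≤ αA) (hμA : αA + 1 ≤ μ) (hμ : α ≤ μ)
    (hA : 1 ≤ A) (hAc : c ≤ A) (hAα : c * (4 * p) ^ α ≤ A) (hAC : 16 * p * C₁ ≤ A)
    (hAp : 16 * p * (p * s) ^ 2 ≤ A) (h : ∀ j, StepBounds ε c αA α C₁ X Q R j) (n : ℕ) :
    ∀ (i j : Fin p) (a b : Fin s), i.val ≤ n → j.val ≤ n →
      |(1 - Qᵀ * Q : Matrix _ _ ℝ) (i, a) (j, b)| ≤ (2 * A) ^ (n + 1) * ε * kappa X ^ ((n : ℝ) - 1 + μ) := by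
  rcases Nat.eq_zero_or_pos p with rfl | hp0
  · exact fun i => i.elim0
  have : NeZero p := ⟨hp0.ne'⟩
  have hκ : 1 ≤ kappa X := one_le_kappa hX
  have hκ0 : 0 < kappa X := by linarith
  have hdiag : ∀ (k : Fin p) (a b : Fin s),
      |(1 - Qᵀ * Q : Matrix _ _ ℝ) (k, a) (k, b)| ≤ ‖1 - (blockCol Q k)ᵀ * blockCol Q k‖ := fun k a b => by
    have h1 := abs_apply_le_norm (1 - (blockCol Q k)ᵀ * blockCol Q k) a b
    have h2 := one_sub_transpose_mul_submatrix Q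
      (f := fun a : Fin s => ((k, a) : Fin p × Fin s)) (fun a b h => by simpa using h) a b
    rw [← h2]
    exact h1
  induction n with
  | zero =>
    intro i j a b hi hj
    obtain rfl : i = j := Fin.ext (by omega)
    refine (hdiag i a b).trans (((h i).first (by omega)).trans ?_)
    -- At n = 0 the exponent is μ - 1, hence the αA + 1 in the maximum.
    have h1 : kappa X ^ αA ≤ kappa X ^ (((0 : ℕ) : ℝ) - 1 + μ) :=
      Real.rpow_le_rpow_of_exponent_le hκ (by push_cast; linarith)
    have h2 : c ≤ (2 * A) ^ (0 + 1) := by rw [zero_add, pow_one]; linarith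
    gcongr
  | succ n ih =>
    set B := (2 * A) ^ (n + 1) with hB
    have hB1 : 1 ≤ B := one_le_pow₀ (by linarith)
    set K := kappa X ^ (((n + 1 : ℕ) : ℝ) - 1 + μ) with hK
    have hK0 : 0 < K := Real.rpow_pos_of_pos hκ0 _
    have hKκ : kappa X ^ ((n : ℝ) - 1 + μ) * kappa X = K := by
      rw [hK, ← Real.rpow_add_one hκ0.ne']
      congr 1
      push_cast
      ring
    have hn0 : (0 : ℝ) ≤ n := Nat.cast_nonneg n
    -- The exponent α enters only from the second block on, where the exponent of `K` is n + μ ≥ α.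
    have hKα : kappa X ^ α ≤ K :=
      Real.rpow_le_rpow_of_exponent_le hκ (by push_cast; linarith)
    have hK1 : kappa X ≤ K := by
      have : kappa X ^ (1 : ℝ) ≤ K :=
        Real.rpow_le_rpow_of_exponent_le hκ (by push_cast; linarith)
      rwa [Real.rpow_one] at this
    have hgoal : (2 * A) ^ (n + 1 + 1) * ε * K = A * (B + B) * ε * K := by
      rw [pow_succ, ← hB]; ring
    rw [hgoal]
    have hold : B * ε * kappa X ^ ((n : ℝ) - 1 + μ) ≤ A * (B + B) * ε * K := by
      have h1 : kappa X ^ ((n : ℝ) - 1 + μ) ≤ K := by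
        rw [← hKκ]
        exact le_mul_of_one_le_right (Real.rpow_nonneg hκ0.le _) hκ
      have h2 : B ≤ A * (B + B) := by nlinarith
      gcongr
    have hnew : ∀ (i k : Fin p) (a b : Fin s), k.val = n + 1 → i < k →
        |(1 - Qᵀ * Q : Matrix _ _ ℝ) (i, a) (k, b)| ≤ A * (B + B) * ε * K := fun i k a b hk hik => by
      -- The factor (ps)² converts the entrywise induction hypothesis into a norm bound.
      set ω := (p * s : ℝ) ^ 2 * (B * ε * kappa X ^ ((n : ℝ) - 1 + μ)) with hωdef
      have hω : ‖1 - (prevCols Q k)ᵀ * prevCols Q k‖ ≤ ω := by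
        refine (norm_le_of_abs_apply_le _
          (c := B * ε * kappa X ^ ((n : ℝ) - 1 + μ)) (by positivity) fun c d => ?_).trans ?_
        · have h2 := one_sub_transpose_mul_submatrix Q (prevIndex_injective (s := s) k) c d
          have h3 := ih c.1 d.1 c.2 d.2 (by have := Fin.lt_def.mp c.1.2; omega)
            (by have := Fin.lt_def.mp d.1.2; omega)
          rw [← h2] at h3
          exact h3
        · have hcard : (Fintype.card ({j : Fin p // j < k} × Fin s) : ℝ) ≤ p * s := by
            exact_mod_cast card_prevIndex_le (s := s) k
          rw [hωdef, sq]
          gcongr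
      have h1 := norm_prevCols_transpose_mul_blockCol_le hX (by omega)
        (fun j _ => h j) hω
      have h2 := (abs_apply_le_norm _ (⟨i, hik⟩, a) b).trans h1
      have h3 : (1 - Qᵀ * Q : Matrix _ _ ℝ) (i, a) (k, b) =
          -((prevCols Q k)ᵀ * blockCol Q k) (⟨i, hik⟩, a) b := by
        have : (1 : Matrix (Fin p × Fin s) (Fin p × Fin s) ℝ) (i, a) (k, b) = 0 :=
          Matrix.one_apply_ne fun h => hik.ne (congrArg Prod.fst h)
        rw [Matrix.sub_apply, this, zero_sub]
        rfl
      rw [h3, abs_neg]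
      refine h2.trans ?_
      -- The fresh error εκ is absorbed because κ ≤ `K`; the inherited error gains one power of κ.
      -- Each costs A·B, whence the growth factor 2A.
      calc 16 * p * (C₁ * ε + ω) * kappa X
          = 16 * p * C₁ * ε * kappa X + 16 * p * (p * s) ^ 2 * (B * ε) *
            (kappa X ^ ((n : ℝ) - 1 + μ) * kappa X) := by rw [hωdef]; ring
        _ ≤ A * ε * K + A * (B * ε) * K := by rw [hKκ]; gcongr
        _ ≤ A * (B * ε) * K + A * (B * ε) * K := by
            have : ε ≤ B * ε := le_mul_of_one_le_left hε hB1
            gcongr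
        _ = _ := by ring
    intro i j a b hi hj
    rcases Nat.lt_or_ge n i.val with hi' | hi' <;> rcases Nat.lt_or_ge n j.val with hj' | hj'
    · obtain rfl : i = j := Fin.ext (by omega)
      refine (hdiag i a b).trans (((h i).succ (by omega)).trans ?_)
      rw [Real.mul_rpow (by positivity) hκ0.le]
      calc c * ε * ((4 * p) ^ α * kappa X ^ α) = c * (4 * p) ^ α * ε * kappa X ^ α := by ring
        _ ≤ A * (B + B) * ε * K := by
            have : A ≤ A * (B + B) := le_mul_of_one_le_right (by linarith) (by linarith)
            have := hAα.trans this
            gcongr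
    · rw [one_sub_transpose_mul_apply_comm]
      exact hnew j i b a (by omega) (Fin.lt_def.mpr (by omega))
    · exact hnew i j a b (by omega) (Fin.lt_def.mpr (by omega))
    · exact (ih i j a b hi' hj').trans hold

/-! ### Choice of the constants and conclusion. -/

theorem mainTheorem6 (m p s : ℕ) (hp : 1 ≤ p) (hs : 1 ≤ s)
    (αA α c : ℝ) (hαA : 0 ≤ αA) (hα : 0 ≤ α) (hc : 0 ≤ c) :
    ∃ C₀ C : ℝ, 0 < C₀ ∧ 0 < C ∧
      ∀ (ε : ℝ) (ioA io : Intraortho m s)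
        (X Q : Matrix (Fin m) (Fin p × Fin s) ℝ)
        (R : Matrix (Fin p × Fin s) (Fin p × Fin s) ℝ),
        0 < ε →
        LinearIndependent ℝ X.col →
        IntraorthoBounds ε c αA (kappa X) ioA →
        IntraorthoBounds ε c α (4 * p * kappa X) io →
        IsComputedBCGSA ε ioA io X Q R →
        C₀ * ε * kappa X ≤ 1 / 2 →
          (∃ ΔX : Matrix (Fin m) (Fin p × Fin s) ℝ,
            X + ΔX = Q * R ∧ ‖ΔX‖ ≤ C * ε * ‖X‖) ∧
          ‖1 - Qᵀ * Q‖ ≤ C * ε * kappa X ^ ((p : ℝ) - 2 + max (αA + 1) α) := by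
  have : NeZero s := ⟨by omega⟩
  have : NeZero p := ⟨by omega⟩
  have hp1 : (1 : ℝ) ≤ p := by exact_mod_cast hp
  obtain ⟨f, hf, hproj⟩ := exists_projection_error_bound m p s
  -- Rounding in the projection plus the backward error cε‖V‖ with ‖V‖ ≤ 2p‖X‖.
  set C₁ : ℝ := f + 2 * p * c with hC₁
  have hC₁0 : 0 ≤ C₁ := by positivity
  have hcC₁ : c ≤ C₁ := by nlinarith
  set d₁ : ℝ := m * (p * s) * C₁ with hd₁
  have hd₁0 : 0 ≤ d₁ := by positivity
  set A : ℝ := 1 + c + c * (4 * p) ^ α + 16 * p * C₁ + 16 * p * (p * s) ^ 2 with hA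
  have hA1 : 0 ≤ c * (4 * p : ℝ) ^ α := by positivity
  have hA2 : 0 ≤ 16 * p * C₁ := by positivity
  have hA3 : (0 : ℝ) ≤ 16 * p * (p * s) ^ 2 := by positivity
  set d₂ : ℝ := (p * s) * (p * s) * (2 * A) ^ p with hd₂
  have hd₂0 : 0 ≤ d₂ := by positivity
  -- In C₀ the 1 forces ε ≤ 1, as κ(X) ≥ 1; the factor 2 makes every perturbation at most
  -- σ_min(X)/4. In C, `d₁` serves the residual and `d₂` the orthogonality.
  refine ⟨1 + 2 * (d₁ + C₁), 1 + d₁ + d₂, by positivity, by positivity, ?_⟩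
  intro ε ioA io X Q R hε hX hioA hio hcomp hsmall
  have hκ : 1 ≤ kappa X := one_le_kappa hX
  have hy0 : 0 < ε * kappa X := by positivity
  have hεy : ε ≤ ε * kappa X := le_mul_of_one_le_right hε.le hκ
  have hy : ε * kappa X + 2 * (d₁ * (ε * kappa X) + C₁ * (ε * kappa X)) ≤ 1 / 2 := by linarith
  have hdy : 0 ≤ d₁ * (ε * kappa X) := by positivity
  have hCy : 0 ≤ C₁ * (ε * kappa X) := by positivity
  have hfy : f * (ε * kappa X) ≤ C₁ * (ε * kappa X) := by
    gcongr
    rw [hC₁]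
    have : 0 ≤ 2 * p * c := by positivity
    linarith
  have hcy : 2 * p * c * (ε * kappa X) ≤ C₁ * (ε * kappa X) := by
    gcongr
    linarith
  -- Earlier blocks enter only through their norms and residuals, so no orthogonality between blocks
  -- is needed here.
  have hstep : ∀ k, StepBounds ε c αA α C₁ X Q R k := by
    intro k
    induction k using WellFoundedLT.induction with
    | ind k ih =>
      rcases Nat.eq_zero_or_pos k.val with hk | hk
      · exact stepBounds_of_val_eq_zero hαA hc hcC₁ hε.le hX hioA hcomp hk
      · obtain ⟨V, hV, hV1, hV2⟩ := hproj ε ioA io X Q R k hε.le (by linarith) hcomp hk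
          fun j hj => (ih j hj).norm_sq_le
        exact stepBounds_of_forall_lt hα hc hf hC₁.ge hε.le hX hio hcomp.lower hk ih hV hV1 hV2
          (by linarith) (by linarith) (by linarith)
  refine ⟨⟨Q * R - X, by abel, ?_⟩, ?_⟩
  · refine (norm_le_of_norm_blockCol_le (by positivity) fun j => (hstep j).residual).trans ?_
    calc m * (p * s) * (C₁ * ε * ‖X‖) = d₁ * ε * ‖X‖ := by rw [hd₁]; ring
      _ ≤ _ := by gcongr; linarith
  · have hent := abs_one_sub_transpose_mul_apply_le hε.le hX hαA (le_max_left (αA + 1) α)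
      (le_max_right (αA + 1) α) (A := A) (by linarith) (by linarith) (by linarith) (by linarith)
      (by linarith) hstep (p - 1)
    have hexp : ((p - 1 : ℕ) : ℝ) - 1 + max (αA + 1) α = (p : ℝ) - 2 + max (αA + 1) α := by
      rw [Nat.cast_sub hp]
      push_cast
      ring
    rw [hexp, Nat.sub_add_cancel hp] at hent
    have hA0 : 0 ≤ A := by positivity
    have hκμ : 0 ≤ kappa X ^ ((p : ℝ) - 2 + max (αA + 1) α) :=
      Real.rpow_nonneg (zero_le_one.trans hκ) _
    clear_value A d₂
    refine (norm_le_of_abs_apply_le (1 - Qᵀ * Q)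
      (c := (2 * A) ^ p * ε * kappa X ^ ((p : ℝ) - 2 + max (αA + 1) α))
      (mul_nonneg (mul_nonneg (pow_nonneg (by linarith) p) hε.le) hκμ)
      fun c d => hent c.1 d.1 c.2 d.2 (by omega) (by omega)).trans ?_
    rw [Fintype.card_prod, Fintype.card_fin, Fintype.card_fin, Nat.cast_mul]
    calc _ = d₂ * ε * kappa X ^ ((p : ℝ) - 2 + max (αA + 1) α) := by rw [hd₂]; ring
      _ ≤ _ := by gcongr; linarith
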